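/- **Setting.** A contextual budget bandit has $N$ arms and $K$ contexts. Arm $i$ is a Markov decision process with states and actions in $\{0,1\}$ (action $1$ means "pull"), with reward $r_i(s,a;k)$ and transition probabilities $P_i[s\to s'\mid a,k]$ in context $k$. In every step a context is drawn, independently of everything else, from a distribution $f=(f_k)_{k\in[K]}$ with all $f_k>0$; given the context and the actions, the arms move independently. The initial joint state has an arbitrary law. Let $B\ge 0$ be the total budget and $\mathcal B_0=\{\vec B\in\mathbb N^K:\sum_k f_kB_k\le B\}$ the finite set of budget allocations. *Occupancy-measure LP:* maximize $\sum_{i,k,s,a}\mu_i(s,a;k)\,r_i(s,a;k)$ over $\mu\ge 0$ subject to $f_{k'}\sum_{k,s,a}P_i[s\to s'\mid a,k]\,\mu_i(s,a;k)=\sum_a\mu_i(s',a;k')$ for all $i,s',k'$; $\sum_{k,s,a}\mu_i(s,a;k)=1$ for all $i$; and $\sum_{i,k,s}\mu_i(s,1;k)\le B$. For $\vec B\in\mathcal B_0$ let $\mathrm{LP}(\vec B)$ be its optimal value with the additional constraints $\frac1{f_k}\sum_{i,s}\mu_i(s,1;k)=B_k$ for all $k$ ($-\infty$ if infeasible). Fix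 an optimal solution $\mu^\star$ of the LP without these additional constraints, and put $\rho_i(s,k)=\frac{\mu^\star_i(s,1;k)}{\mu^\star_i(s,0;k)+\mu^\star_i(s,1;k)}\,r_i(s,1;k)$ (with $0/0=0$). The index policy with allocation $\vec B$ pulls, in context $k$, the $\min(B_k,N)$ arms of highest index $\rho_i(s_i,k)$; ties are broken by any fixed rule depending on the context, its budget and the joint state. Let $\mu(\vec B)$ be its long-run average expected reward, $\mu^\star_{\max}=\max_{\vec B\in\mathcal B_0}\mu(\vec B)$, and $\Delta(\vec B)=\mu^\star_{\max}-\mu(\vec B)$. *Oracle:* each call with $\vec B$ returns $\mu(\vec B)+\epsilon$, all answers being independent, where $\epsilon$ has mean zero and is sub-Gaussian with variance proxy $\sigma^2$. *Mitosis algorithm* (with constant $c>0$): initially all of $\mathcal B_0$ lies in the TreeArm. After $t$ rounds, an allocation $\vec B$ that has been pulled $N_t(\vec B)\ge1$ times, with empirical mean $\hat\mu_t(\vec B)$, is a standard arm with index $I_t(\vec B)=\hat\mu_t(\vec B)+c\sqrt{\log t/N_t(\vec B)}$; the TreeArm consists of the allocations not yet pulled and has index $\max_{\vec B\in\mathrm{TreeArm}}\mathrm{LP}(\vec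 B)$. In each round a candidate (standard arm or TreeArm) of highest index is selected. A selected standard arm is pulled (one oracle call). If the TreeArm is selected, an allocation of the TreeArm with maximal $\mathrm{LP}$ value is split off, becomes a standard arm and is pulled. Ties are broken arbitrarily. Let $\vec B_t$ be the allocation pulled in round $t$, $R(T)=\sum_{t=1}^T\bigl(\mu^\star_{\max}-\mu(\vec B_t)\bigr)$, $A_T$ the random set of allocations pulled in the first $T$ rounds, and $\mathcal A_T=\{\vec B:\Pr(\vec B\in A_T)>0\}$. **Theorem (No-regret of the Mitosis algorithm).** Let $c>0$, $\sigma\ge0$ with $c^2>2\sigma^2$, and let $D\in\mathbb R$. There is a constant $C>0$, depending only on $c,\sigma,D$, such that for every contextual budget bandit with $\Delta(\vec B)\le D$ for all $\vec B\in\mathcal B_0$ and every run of Mitosis as above: 1. for all $T$, $R(T)=\sum_{\vec B\in A_T}N_T(\vec B)\,\Delta(\vec B)$ on every realization, and $\mathbb E[R(T)]=\sum_{\vec B\in\mathcal A_T}\mathbb E[N_T(\vec B)]\,\Delta(\vec B)$; 2. for all $T\ge2$, $$\mathbb E[R(T)]\le C\sum_{\vec B\in\mathcal A_T,\ \Delta(\vec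 B)>0}\frac{\log T}{\Delta(\vec B)};$$ 3. as $T\to\infty$, with an implied constant that may depend on the instance and the run, $$\mathbb E[R(T)]=O\Bigl(\mathbb E\Bigl[\sum_{\vec B\in A_T,\ \Delta(\vec B)>0}\frac{\log T}{\Delta(\vec B)}\Bigr]\Bigr).$$ -/

import Mathlib

open MeasureTheory ProbabilityTheory Filter

noncomputable section

/-- A contextual budget bandit with `N` arms and `K` contexts. Every arm is a two-state,
two-action Markov decision process: the state `true` is the state `1`, the action `true` is
"pull". `r i k s a` is the reward and `P i k s a s'` the transition probability of arm `i` in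
context `k`, `f` the context distribution, `B` the total budget, and `init` the law of the joint
state at the start. -/
structure CBB (N K : ℕ) where
  r : Fin N → Fin K → Bool → Bool → ℝ
  P : Fin N → Fin K → Bool → Bool → Bool → ℝ
  P_nonneg : ∀ i k s a s', 0 ≤ P i k s a s'
  P_sum : ∀ i k s a, ∑ s', P i k s a s' = 1
  f : Fin K → ℝ
  f_pos : ∀ k, 0 < f k
  f_sum : ∑ k, f k = 1
  B : ℝ
  B_nonneg : 0 ≤ B
  init : (Fin N → Bool) → ℝ
  init_nonneg : ∀ s, 0 ≤ init s
  init_sum : ∑ s, init s = 1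

namespace CBB

variable {N K : ℕ} (M : CBB N K)

/-! ### Budget allocations -/

/-- The set `𝓑₀` of budget allocations `b ∈ ℕ^K` with `∑ₖ fₖ bₖ ≤ B`. These are the arms of the
associated multi-armed bandit. -/
abbrev Alloc : Type := {b : Fin K → ℕ // ∑ k, M.f k * (b k : ℝ) ≤ M.B}

instance : Finite M.Alloc := by
  have hsub : {b : Fin K → ℕ | ∑ k, M.f k * (b k : ℝ) ≤ M.B} ⊆
      Set.Iic (fun k => ⌊M.B / M.f k⌋₊) := by
    intro b hb k
    have h1 : M.f k * (b k : ℝ) ≤ ∑ k, M.f k * (b k : ℝ) :=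
      Finset.single_le_sum (f := fun k => M.f k * (b k : ℝ))
        (fun j _ => mul_nonneg (M.f_pos j).le (Nat.cast_nonneg _)) (Finset.mem_univ k)
    have h2 : (b k : ℝ) ≤ M.B / M.f k := by
      rw [le_div_iff₀ (M.f_pos k), mul_comm]
      exact h1.trans hb
    exact Nat.le_floor h2
  exact ((Set.finite_Iic _).subset hsub).to_subtype

instance : Fintype M.Alloc := Fintype.ofFinite _

instance : Nonempty M.Alloc := ⟨⟨fun _ => 0, by simpa using M.B_nonneg⟩⟩

/-! ### The occupancy-measure linear program

A candidate occupancy measure is a function `μ i s a k`. -/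

/-- The objective of the occupancy-measure LP. -/
def lpObjective (μ : Fin N → Bool → Bool → Fin K → ℝ) : ℝ :=
  ∑ i, ∑ k, ∑ s, ∑ a, μ i s a k * M.r i k s a

/-- The constraints of the occupancy-measure LP. -/
structure LPFeasible (μ : Fin N → Bool → Bool → Fin K → ℝ) : Prop where
  flow : ∀ k' s' i, M.f k' * (∑ k, ∑ s, ∑ a, M.P i k s a s' * μ i s a k) = ∑ a, μ i s' a k'
  total : ∀ i, ∑ k, ∑ a, ∑ s, μ i s a k = 1
  budget : ∑ k, ∑ i, ∑ s, μ i s true k ≤ M.B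
  nonneg : ∀ i s a k, 0 ≤ μ i s a k

/-- `μ` is an optimal solution of the occupancy-measure LP. -/
def LPOptimal (μ : Fin N → Bool → Bool → Fin K → ℝ) : Prop :=
  M.LPFeasible μ ∧ ∀ ν, M.LPFeasible ν → M.lpObjective ν ≤ M.lpObjective μ

/-- `LP(b)`: the optimal value of the occupancy-measure LP with the additional constraints
`(1 / fₖ) ∑_{i, s} μ_i(s, 1; k) = bₖ` for all `k`; it is `-∞` if these make it infeasible. -/
def LP (b : M.Alloc) : EReal :=
  sSup {x : EReal | ∃ μ : Fin N → Bool → Bool → Fin K → ℝ, M.LPFeasible μ ∧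
    (∀ k, 1 / M.f k * (∑ i, ∑ s, μ i s true k) = (b.1 k : ℝ)) ∧ x = (M.lpObjective μ : EReal)}

/-! ### The index policy with a given budget allocation, and its reward -/

/-- The contextual occupancy index `ρ_i(s, k)` computed from the LP solution `μ`. -/
def occIndex (μ : Fin N → Bool → Bool → Fin K → ℝ) (i : Fin N) (s : Bool) (k : Fin K) : ℝ :=
  μ i s true k / (μ i s false k + μ i s true k) * M.r i k s true

/-- `sel k n s` is the set of arms pulled in context `k` with budget `n` in the joint state `s`. It
is a rule that pulls the `n` arms with the highest contextual occupancy index (all arms if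
`n ≥ N`); ties may be broken in any way. -/
def IsIndexRule (μ : Fin N → Bool → Bool → Fin K → ℝ)
    (sel : Fin K → ℕ → (Fin N → Bool) → Finset (Fin N)) : Prop :=
  ∀ k n s, (sel k n s).card = min n N ∧
    ∀ i ∈ sel k n s, ∀ j ∉ sel k n s, M.occIndex μ j (s j) k ≤ M.occIndex μ i (s i) k

/-- The law of the joint state at time `t` if the arms in `act k s` are pulled in context `k` and
joint state `s`: at each time step a context is drawn from `f` independently of everything else,
and given the context and the actions the arms move independently. -/
def stateLaw (act : Fin K → (Fin N → Bool) → Finset (Fin N)) : ℕ → (Fin N → Bool) → ℝ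
  | 0 => M.init
  | t + 1 => fun s' => ∑ s, ∑ k, stateLaw act t s * M.f k *
      ∏ i, M.P i k (s i) (decide (i ∈ act k s)) (s' i)

/-- The expected reward collected at time `t`. -/
def stepReward (act : Fin K → (Fin N → Bool) → Finset (Fin N)) (t : ℕ) : ℝ :=
  ∑ s, ∑ k, M.stateLaw act t s * M.f k * ∑ i, M.r i k (s i) (decide (i ∈ act k s))

/-- The long-run average expected reward. The averages converge, as they do for every finite
Markov chain, so that this upper limit is the limit. -/
def avgReward (act : Fin K → (Fin N → Bool) → Finset (Fin N)) : ℝ :=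
  limsup (fun T : ℕ => (∑ t ∈ Finset.range T, M.stepReward act t) / (T : ℝ)) atTop

/-- `Reward(b)`: the reward of the index policy with the budget allocation `b`. -/
def reward (sel : Fin K → ℕ → (Fin N → Bool) → Finset (Fin N)) (b : M.Alloc) : ℝ :=
  M.avgReward (fun k => sel k (b.1 k))

/-! ### The bandit over budget allocations

The mean of the bandit arm `b` is `μ(b) = Reward(b)`. -/

variable (sel : Fin K → ℕ → (Fin N → Bool) → Finset (Fin N))

/-- The gap `Δ(b) = μ⋆ - μ(b)`, where `μ⋆` is the maximum of `μ` over all allocations. -/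
def gap (b : M.Alloc) : ℝ :=
  Finset.univ.sup' Finset.univ_nonempty (M.reward sel) - M.reward sel b

/-- The fast oracle: `X b n` is the answer to the `n`-th call (counted from `0`) with the
allocation `b`. The answers are independent, and each is the true reward plus a centred
sub-Gaussian noise of variance proxy `σ ^ 2`. -/
structure IsFastOracle {Ω : Type*} [MeasurableSpace Ω] (Pr : Measure Ω) (σ : NNReal)
    (X : M.Alloc → ℕ → Ω → ℝ) : Prop where
  meas : ∀ b n, Measurable (X b n)
  indep : iIndepFun (fun p : M.Alloc × ℕ => X p.1 p.2) Pr
  mean : ∀ b n, ∫ ω, X b n ω ∂Pr = M.reward sel b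
  subG : ∀ b n, HasSubgaussianMGF (fun ω => X b n ω - M.reward sel b) (σ ^ 2) Pr

/-! ### The Mitosis algorithm

`arm t` is the allocation pulled in round `t + 1`, that is, when `t` rounds are over; `x b n` is
the answer to the `n`-th oracle call for `b`. Both are given along one realization. -/

/-- `N_t(b)`: the number of pulls of `b` in the first `t` rounds. -/
def pulls (arm : ℕ → M.Alloc) (t : ℕ) (b : M.Alloc) : ℕ :=
  ((Finset.range t).filter (fun s => arm s = b)).card

/-- The standard candidate arms: the allocations pulled in the first `t` rounds. -/
def pulled (arm : ℕ → M.Alloc) (t : ℕ) : Finset M.Alloc :=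
  (Finset.range t).image arm

/-- The content of the TreeArm after `t` rounds: the allocations not yet split off. -/
def tree (arm : ℕ → M.Alloc) (t : ℕ) : Finset M.Alloc :=
  Finset.univ \ M.pulled arm t

/-- The empirical mean of `b` after `t` rounds. -/
def empMean (x : M.Alloc → ℕ → ℝ) (arm : ℕ → M.Alloc) (t : ℕ) (b : M.Alloc) : ℝ :=
  (∑ n ∈ Finset.range (M.pulls arm t b), x b n) / (M.pulls arm t b : ℝ)

/-- The UCB1 index of a standard arm. -/
def ucbIndex (c : ℝ) (x : M.Alloc → ℕ → ℝ) (arm : ℕ → M.Alloc) (t : ℕ) (b : M.Alloc) : ℝ :=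
  M.empMean x arm t b + c * Real.sqrt (Real.log t / (M.pulls arm t b : ℝ))

/-- The index of the TreeArm, `max_{b ∈ TreeArm} LP(b)` (`-∞` if the TreeArm is empty). -/
def treeIndex (arm : ℕ → M.Alloc) (t : ℕ) : EReal :=
  (M.tree arm t).sup M.LP

/-- A standard arm of highest index among all candidates (the TreeArm included) is pulled. -/
def StandardStep (c : ℝ) (x : M.Alloc → ℕ → ℝ) (arm : ℕ → M.Alloc) (t : ℕ) : Prop :=
  arm t ∈ M.pulled arm t ∧
    (∀ b ∈ M.pulled arm t, M.ucbIndex c x arm t b ≤ M.ucbIndex c x arm t (arm t)) ∧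
    M.treeIndex arm t ≤ (M.ucbIndex c x arm t (arm t) : EReal)

/-- The TreeArm has the highest index among all candidates; it splits off, and pulls, one of its
allocations with the highest LP value. -/
def TreeStep (c : ℝ) (x : M.Alloc → ℕ → ℝ) (arm : ℕ → M.Alloc) (t : ℕ) : Prop :=
  (∀ b ∈ M.pulled arm t, (M.ucbIndex c x arm t b : EReal) ≤ M.treeIndex arm t) ∧
    arm t ∈ M.tree arm t ∧ ∀ b ∈ M.tree arm t, M.LP b ≤ M.LP (arm t)

/-- `arm` is a run of Mitosis on the oracle answers `x`; ties may be broken in any way. -/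
def IsMitosisRun (c : ℝ) (x : M.Alloc → ℕ → ℝ) (arm : ℕ → M.Alloc) : Prop :=
  ∀ t, M.StandardStep c x arm t ∨ M.TreeStep c x arm t

/-- The cumulative regret `R(T) = ∑_{t ≤ T} (μ⋆ - μ(b_t))`. -/
def regret (arm : ℕ → M.Alloc) (T : ℕ) : ℝ :=
  ∑ t ∈ Finset.range T, M.gap sel (arm t)

end CBB

end

/-!
Mitosis is UCB1 on the allocations, with all unpulled allocations represented by one optimistic
index, the largest `LP` value among them. Two facts make the UCB1 analysis go through.

*The TreeArm is optimistic.* If the rule pulls exactly `b k` arms in every context `k`, a limit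
point of the Cesàro averages of the laws of the joint state is a stationary law whose one-step
reward is the long-run average reward (up to an arbitrarily small loss), and its occupancy measure
is feasible for the linear program that defines `LP b`. So `M.reward sel b ≤ M.LP b`
(`avgReward_le_LP`). For an allocation with some `b k > N` the program is infeasible, but truncating
`b` at `N` does not change the index policy; hence some optimal allocation `bopt` satisfies
`M.reward sel bopt ≤ M.LP bopt` (`exists_optimal_le_LP`). Until `bopt` is split off, the TreeArm
index is then at least the optimal mean, so a repeated pull of an allocation `b` after `t` rounds
means that the index of `b` is at least the optimal mean, unless `bopt` is a standard arm whose
upper confidence bound fails. This gives a pathwise bound on the number of pulls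
(`pulls_le_card_add_card`).

*The confidence bounds hold for every `c ^ 2 > 2 σ ^ 2`.* A union bound over the possible numbers of
pulls of `bopt` would give failure probabilities `t ^ (1 - c ^ 2 / (2 σ ^ 2))`, which need not be
summable. Instead the numbers of pulls are cut into `O(log t)` blocks `[β ^ j, β ^ (j + 1)]`, and
Doob's maximal inequality handles each block at once, at the price of a factor `β` in the exponent
(`measureReal_exists_sqrt_log_le_sum_le`). For `β` close to `1` the sum over `t` converges to a
constant that depends on `c` and `σ` only. The index of `b` exceeds the optimal mean for
`O(log T / Δ ^ 2)` numbers of pulls in expectation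
(`sum_measureReal_le_average_add_bonus_le`), so that `b` contributes `O(log T / Δ)` to the regret.

The bound over the random set of pulled allocations follows, since the probability that an
allocation has been pulled is nondecreasing in `T` and there are finitely many allocations, so that
the probabilities that are positive are eventually bounded below (`isBigO_integral_sum_pulled`).
-/

noncomputable section

/-! ### Concentration of sub-Gaussian sums -/

section Concentration

variable {Ω : Type*} [MeasurableSpace Ω] {Pr : Measure Ω} {Y : ℕ → Ω → ℝ} {v : NNReal}

theorem one_le_mgf_of_integral_eq_zero [IsProbabilityMeasure Pr] {Z : Ω → ℝ}
    (hs : HasSubgaussianMGF Z v Pr) (hmean : ∫ ω, Z ω ∂Pr = 0) (l : ℝ) : 1 ≤ mgf Z Pr l := by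
  have h : ∫ ω, (l * Z ω + 1) ∂Pr ≤ ∫ ω, Real.exp (l * Z ω) ∂Pr :=
    integral_mono ((hs.integrable.const_mul l).add (integrable_const _))
      (hs.integrable_exp_mul l) fun ω => Real.add_one_le_exp _
  rw [integral_add (hs.integrable.const_mul l) (integrable_const _), integral_const_mul,
    hmean] at h
  simpa [mgf] using h

/-- Each factor `exp (l * Y n)` is independent of the past and has mean at least `1`. The partial sums
start with one summand, so that the natural filtration of `Y` itself is the right one. -/
theorem submartingale_exp_sum [IsProbabilityMeasure Pr] (hm : ∀ n, Measurable (Y n))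
    (hi : iIndepFun Y Pr) (hs : ∀ n, HasSubgaussianMGF (Y n) v Pr)
    (hmean : ∀ n, ∫ ω, Y n ω ∂Pr = 0) (l : ℝ) :
    Submartingale (fun n ω => Real.exp (l * ∑ i ∈ Finset.range (n + 1), Y i ω))
      (Filtration.natural Y fun n => (hm n).stronglyMeasurable) Pr := by
  have hint : ∀ n, Integrable (fun ω => Real.exp (l * ∑ i ∈ Finset.range (n + 1), Y i ω)) Pr :=
    fun n => (HasSubgaussianMGF.sum_of_iIndepFun hi fun i _ => hs i).integrable_exp_mul l
  have hadap : StronglyAdapted (Filtration.natural Y fun n => (hm n).stronglyMeasurable)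
      (fun n ω => Real.exp (l * ∑ i ∈ Finset.range (n + 1), Y i ω)) := by
    intro n
    refine Real.continuous_exp.comp_stronglyMeasurable (StronglyMeasurable.const_mul ?_ l)
    refine Finset.stronglyMeasurable_fun_sum _ fun i hi => ?_
    exact (Filtration.stronglyAdapted_natural (fun n => (hm n).stronglyMeasurable) i).mono
      ((Filtration.natural Y _).mono (Nat.lt_succ_iff.1 (Finset.mem_range.1 hi)))
  refine submartingale_nat hadap hint fun n => ?_
  have hsplit : (fun ω => Real.exp (l * ∑ i ∈ Finset.range (n + 1 + 1), Y i ω)) =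
      (fun ω => Real.exp (l * ∑ i ∈ Finset.range (n + 1), Y i ω)) *
        fun ω => Real.exp (l * Y (n + 1) ω) := by
    ext ω
    rw [Finset.sum_range_succ, mul_add, Real.exp_add]; rfl
  have hpull := condExp_mul_of_stronglyMeasurable_left (hadap n)
    (hsplit ▸ hint (n + 1)) ((hs (n + 1)).integrable_exp_mul l)
  have hindep : Indep (MeasurableSpace.comap (Y (n + 1)) inferInstance)
      (Filtration.natural Y (fun n => (hm n).stronglyMeasurable) n) Pr :=
    hi.indep_comap_natural_of_lt _ n.lt_succ_self
  have hce := condExp_indep_eq (hm (n + 1)).comap_le ((Filtration.natural Y _).le n)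
    (f := fun ω => Real.exp (l * Y (n + 1) ω))
    (Measurable.stronglyMeasurable
      (Real.measurable_exp.comp ((comap_measurable (Y (n + 1))).const_mul l))) hindep
  rw [hsplit]
  filter_upwards [hpull, hce] with ω h1 h2
  rw [h1, Pi.mul_apply, h2]
  exact le_mul_of_one_le_right (Real.exp_pos _).le
    (one_le_mgf_of_integral_eq_zero (hs (n + 1)) (hmean (n + 1)) l)

/-- The maximal form of Hoeffding's inequality, with the constant of the bound for the last partial
sum alone: Doob's maximal inequality for `exp (l * ∑ Y i)` with `l = x / (n * v)`. -/
theorem measureReal_exists_le_sum_le_exp [IsProbabilityMeasure Pr] (hm : ∀ n, Measurable (Y n))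
    (hi : iIndepFun Y Pr) (hs : ∀ n, HasSubgaussianMGF (Y n) v Pr)
    (hmean : ∀ n, ∫ ω, Y n ω ∂Pr = 0) (hv : 0 < v) (n : ℕ) {x : ℝ} (hx : 0 ≤ x) :
    Pr.real {ω | ∃ s ∈ Finset.Icc 1 n, x ≤ ∑ i ∈ Finset.range s, Y i ω} ≤
      Real.exp (-(x ^ 2 / (2 * n * v))) := by
  have hv' : (0 : ℝ) < v := hv
  rcases n with _ | n
  · simp
  set l : ℝ := x / ((n + 1 : ℕ) * v) with hl
  have hl0 : 0 ≤ l := by positivity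
  set f : ℕ → Ω → ℝ := fun n ω => Real.exp (l * ∑ i ∈ Finset.range (n + 1), Y i ω) with hf
  have hsub := submartingale_exp_sum hm hi hs hmean l
  have hmax := maximal_ineq hsub (fun k ω => (Real.exp_pos _).le)
    (ε := (Real.exp (l * x)).toNNReal) n
  set E : Set Ω := {ω | ((Real.exp (l * x)).toNNReal : ℝ) ≤
    (Finset.range (n + 1)).sup' Finset.nonempty_range_add_one fun k => f k ω} with hE
  have hsubset : {ω | ∃ s ∈ Finset.Icc 1 (n + 1), x ≤ ∑ i ∈ Finset.range s, Y i ω} ⊆ E := by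
    rintro ω ⟨s, hs, hxs⟩
    rw [Finset.mem_Icc] at hs
    rw [hE, Set.mem_ofPred_eq, Finset.le_sup'_iff]
    -- the process at time `k` has `k + 1` summands
    refine ⟨s - 1, Finset.mem_range.2 (by omega), ?_⟩
    simp only [hf, Real.coe_toNNReal _ (Real.exp_pos _).le]
    rw [Nat.sub_add_cancel hs.1]
    gcongr
  have hmgf : ∫ ω, f n ω ∂Pr ≤ Real.exp ((n + 1 : ℕ) * v * l ^ 2 / 2) := by
    have h := (HasSubgaussianMGF.sum_of_iIndepFun (s := Finset.range (n + 1)) hi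
      fun i _ => hs i).mgf_le l
    simpa [mgf] using h
  have hint : ∫ ω in E, f n ω ∂Pr ≤ ∫ ω, f n ω ∂Pr :=
    setIntegral_le_integral (hsub.integrable n) (ae_of_all _ fun ω => (Real.exp_pos _).le)
  have hreal : Real.exp (l * x) * Pr.real E ≤ Real.exp ((n + 1 : ℕ) * v * l ^ 2 / 2) := by
    have h := ENNReal.toReal_mono ENNReal.ofReal_ne_top hmax
    rw [ENNReal.toReal_ofReal (setIntegral_nonneg_of_ae (ae_of_all _ fun ω => (Real.exp_pos _).le))]
      at h
    rw [ENNReal.toReal_mul, ENNReal.coe_toReal, Real.coe_toNNReal _ (Real.exp_pos _).le] at h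
    exact (h.trans hint).trans hmgf
  calc _ ≤ Pr.real E := measureReal_mono hsubset
    _ ≤ Real.exp ((n + 1 : ℕ) * v * l ^ 2 / 2) / Real.exp (l * x) := by
      rw [le_div_iff₀ (Real.exp_pos _), mul_comm]; exact hreal
    _ = _ := by
      rw [← Real.exp_sub]
      congr 1
      rw [hl]; field_simp; ring

/-- Peeling: the range `[1, t]` of `s` is covered by at most `1 + log t / log β` blocks
`[β ^ j, β ^ (j + 1)]`, and the maximal inequality is applied on each of them. -/
theorem measureReal_exists_sqrt_log_le_sum_le [IsProbabilityMeasure Pr]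
    (hm : ∀ n, Measurable (Y n))
    (hi : iIndepFun Y Pr) (hs : ∀ n, HasSubgaussianMGF (Y n) v Pr)
    (hmean : ∀ n, ∫ ω, Y n ω ∂Pr = 0) (hv : 0 < v) {c β : ℝ} (hc : 0 < c) (hβ : 1 < β) {t : ℕ}
    (ht : 1 ≤ t) :
    Pr.real {ω | ∃ s ∈ Finset.Icc 1 t,
        c * Real.sqrt (s * Real.log t) ≤ ∑ i ∈ Finset.range s, Y i ω} ≤
      (1 + Real.log t / Real.log β) * (t : ℝ) ^ (-(c ^ 2 / (2 * v * β))) := by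
  have hv' : (0 : ℝ) < v := hv
  have hlog : 0 ≤ Real.log t := Real.log_natCast_nonneg t
  have hlogβ : 0 < Real.log β := Real.log_pos hβ
  have htpos : (0 : ℝ) < t := by exact_mod_cast ht
  set J := ⌊Real.log t / Real.log β⌋₊ with hJ
  set E : ℕ → Set Ω := fun j => {ω | ∃ s ∈ Finset.Icc 1 ⌊β ^ (j + 1)⌋₊,
    c * Real.sqrt (β ^ j * Real.log t) ≤ ∑ i ∈ Finset.range s, Y i ω} with hE
  have hcover : {ω | ∃ s ∈ Finset.Icc 1 t,
      c * Real.sqrt (s * Real.log t) ≤ ∑ i ∈ Finset.range s, Y i ω} ⊆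
      ⋃ j ∈ Finset.range (J + 1), E j := by
    rintro ω ⟨s, hs, hsum⟩
    rw [Finset.mem_Icc] at hs
    have hs1 : (1 : ℝ) ≤ s := by exact_mod_cast hs.1
    obtain ⟨j, hj1, hj2⟩ := exists_nat_pow_near hs1 hβ
    have hjlog : j * Real.log β ≤ Real.log t := by
      rw [← Real.log_pow]
      exact Real.log_le_log (by positivity) (hj1.trans (by exact_mod_cast hs.2))
    simp only [Set.mem_iUnion, Finset.mem_range, hE]
    refine ⟨j, Nat.lt_succ_iff.2 (Nat.le_floor ((le_div_iff₀ hlogβ).2 hjlog)), s,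
      Finset.mem_Icc.2 ⟨hs.1, Nat.le_floor hj2.le⟩, le_trans ?_ hsum⟩
    gcongr
  have hEj : ∀ j ∈ Finset.range (J + 1), Pr.real (E j) ≤
      (t : ℝ) ^ (-(c ^ 2 / (2 * v * β))) := by
    intro j _
    refine (measureReal_exists_le_sum_le_exp hm hi hs hmean hv _ (by positivity)).trans ?_
    rw [Real.rpow_def_of_pos htpos, Real.exp_le_exp, mul_pow, Real.sq_sqrt (by positivity)]
    have hfl : (⌊β ^ (j + 1)⌋₊ : ℝ) ≤ β ^ (j + 1) := Nat.floor_le (by positivity)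
    have hfl1 : (0 : ℝ) < ⌊β ^ (j + 1)⌋₊ := by
      exact_mod_cast Nat.floor_pos.2 (one_le_pow₀ hβ.le)
    have : c ^ 2 * (β ^ j * Real.log t) / (2 * β ^ (j + 1) * v) ≤
        c ^ 2 * (β ^ j * Real.log t) / (2 * ⌊β ^ (j + 1)⌋₊ * v) := by gcongr
    have h2 : c ^ 2 * (β ^ j * Real.log t) / (2 * β ^ (j + 1) * v) =
        Real.log t * (c ^ 2 / (2 * v * β)) := by
      field_simp; ring
    linarith
  calc _ ≤ Pr.real (⋃ j ∈ Finset.range (J + 1), E j) := measureReal_mono hcover (measure_ne_top _ _)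
    _ ≤ ∑ j ∈ Finset.range (J + 1), Pr.real (E j) := measureReal_biUnion_finset_le _ _
    _ ≤ ∑ j ∈ Finset.range (J + 1), (t : ℝ) ^ (-(c ^ 2 / (2 * v * β))) := Finset.sum_le_sum hEj
    _ = ((J : ℝ) + 1) * (t : ℝ) ^ (-(c ^ 2 / (2 * v * β))) := by simp
    _ ≤ _ := by
      rw [add_comm (1 : ℝ)]
      gcongr
      exact Nat.floor_le (by positivity)

theorem summable_log_mul_rpow {b γ : ℝ} (hγ : 1 < γ) :
    Summable fun t : ℕ => (1 + Real.log t / b) * (t : ℝ) ^ (-γ) := by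
  have h1 : Summable fun t : ℕ => (t : ℝ) ^ (-γ) := Real.summable_nat_rpow.2 (by linarith)
  set δ := (γ - 1) / 2 with hδ
  have hδ0 : 0 < δ := by rw [hδ]; linarith
  have h2 : Summable fun t : ℕ => Real.log t * (t : ℝ) ^ (-γ) := by
    refine Summable.of_nonneg_of_le (fun t => mul_nonneg (Real.log_natCast_nonneg t) (by positivity))
      (fun t => ?_) ((Real.summable_nat_rpow.2 (show δ - γ < -1 by rw [hδ]; linarith)).mul_left δ⁻¹)
    rcases t.eq_zero_or_pos with rfl | ht
    · simp; positivity
    · have htp : (0 : ℝ) < t := by exact_mod_cast ht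
      calc _ ≤ (t : ℝ) ^ δ / δ * (t : ℝ) ^ (-γ) := by
            gcongr
            exact Real.log_le_rpow_div htp.le hδ0
        _ = _ := by rw [sub_eq_add_neg, Real.rpow_add htp]; ring
  convert h1.add (h2.mul_left b⁻¹) using 2 with t
  ring

theorem sum_Icc_exp_neg_mul_le {q : ℝ} (hq : 0 < q) (T : ℕ) :
    ∑ s ∈ Finset.Icc 1 T, Real.exp (-(q * s)) ≤ 1 / q := by
  suffices h : ∑ s ∈ Finset.Icc 1 T, Real.exp (-(q * s)) ≤ (1 - Real.exp (-(q * T))) / q by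
    refine h.trans ?_
    gcongr
    linarith [Real.exp_pos (-(q * T))]
  induction T with
  | zero => simp
  | succ T ih =>
    rw [Finset.sum_Icc_succ_top (by omega)]
    have hstep : q * Real.exp (-(q * (T + 1 : ℕ))) ≤
        Real.exp (-(q * T)) - Real.exp (-(q * (T + 1 : ℕ))) := by
      have : Real.exp (-(q * T)) = Real.exp q * Real.exp (-(q * (T + 1 : ℕ))) := by
        rw [← Real.exp_add]; congr 1; push_cast; ring
      rw [this]
      nlinarith [Real.add_one_le_exp q, Real.exp_pos (-(q * (T + 1 : ℕ)))]
    rw [le_div_iff₀ hq] at ih ⊢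
    linarith

/-- The expected number of sample sizes `s` for which an average of centred samples plus the UCB1 bonus
reaches the gap `Δ`. As soon as `s > 4 * c ^ 2 * log T / Δ ^ 2` the bonus is at most `Δ / 2`, and the
average itself has to reach `Δ / 2`. -/
theorem sum_measureReal_le_average_add_bonus_le [IsProbabilityMeasure Pr] (hi : iIndepFun Y Pr)
    (hs : ∀ n, HasSubgaussianMGF (Y n) v Pr) (hv : 0 < v) {c Δ : ℝ} (hc : 0 < c) (hΔ : 0 < Δ)
    (T : ℕ) :
    ∑ s ∈ Finset.Icc 1 T, Pr.real {ω | Δ ≤ (∑ i ∈ Finset.range s, Y i ω) / s +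
        c * Real.sqrt (Real.log T / s)} ≤
      4 * c ^ 2 * Real.log T / Δ ^ 2 + 8 * v / Δ ^ 2 := by
  have hv' : (0 : ℝ) < v := hv
  have hlog : 0 ≤ Real.log T := Real.log_natCast_nonneg T
  set u := 4 * c ^ 2 * Real.log T / Δ ^ 2 with hu
  have hu0 : 0 ≤ u := by positivity
  have hterm : ∀ s ∈ Finset.Icc 1 T, Pr.real {ω | Δ ≤ (∑ i ∈ Finset.range s, Y i ω) / s +
        c * Real.sqrt (Real.log T / s)} ≤
      (if (s : ℝ) ≤ u then 1 else 0) + Real.exp (-(Δ ^ 2 / (8 * v) * s)) := by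
    intro s hsT
    rw [Finset.mem_Icc] at hsT
    have hs0 : (0 : ℝ) < s := by exact_mod_cast hsT.1
    split_ifs with hsu
    · linarith [measureReal_le_one (μ := Pr) (s := {ω | Δ ≤ (∑ i ∈ Finset.range s, Y i ω) / s +
        c * Real.sqrt (Real.log T / s)}), Real.exp_pos (-(Δ ^ 2 / (8 * v) * s))]
    · have hbonus : c * Real.sqrt (Real.log T / s) ≤ Δ / 2 := by
        rw [← le_div_iff₀' hc]
        refine Real.sqrt_le_iff.2 ⟨by positivity, ?_⟩
        rw [div_le_iff₀ hs0]
        rw [not_le, hu, div_lt_iff₀ (by positivity)] at hsu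
        rw [div_pow, div_pow, div_div, div_mul_eq_mul_div, le_div_iff₀ (by positivity)]
        linarith
      have hsub : {ω | Δ ≤ (∑ i ∈ Finset.range s, Y i ω) / s +
          c * Real.sqrt (Real.log T / s)} ⊆
          {ω | s * (Δ / 2) ≤ ∑ i ∈ Finset.range s, Y i ω} := by
        intro ω hω
        simp only [Set.mem_ofPred_eq] at hω ⊢
        rw [← le_div_iff₀' hs0]
        linarith
      refine (measureReal_mono hsub).trans
        ((HasSubgaussianMGF.measure_sum_range_ge_le_of_iIndepFun hi (fun i _ => hs i)
          (by positivity)).trans ?_)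
      rw [zero_add, Real.exp_le_exp]
      apply le_of_eq
      field_simp
      ring
  refine (Finset.sum_le_sum hterm).trans ?_
  rw [Finset.sum_add_distrib]
  gcongr
  · rw [Finset.sum_ite, Finset.sum_const_zero, add_zero, Finset.sum_const, nsmul_one]
    refine le_trans ?_ (Nat.floor_le hu0)
    rw [Nat.cast_le]
    refine (Finset.card_le_card (t := Finset.Icc 1 ⌊u⌋₊) fun s hs => ?_).trans (by simp)
    simp only [Finset.mem_filter, Finset.mem_Icc] at hs ⊢
    exact ⟨hs.1.1, Nat.le_floor hs.2⟩
  · refine (sum_Icc_exp_neg_mul_le (by positivity) T).trans (le_of_eq ?_)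
    field_simp

end Concentration

/-! ### The linear program bounds the reward of an allocation -/

namespace CBB

variable {N K : ℕ} (M : CBB N K)

section OccupancyBound

variable (act : Fin K → (Fin N → Bool) → Finset (Fin N))

/-- The joint Markov chain acting on signed laws of the joint state: one time step under the
action rule `act`. -/
def stepLaw : ((Fin N → Bool) → ℝ) →ₗ[ℝ] ((Fin N → Bool) → ℝ) where
  toFun p := fun s' => ∑ s, ∑ k, p s * M.f k *
      ∏ i, M.P i k (s i) (decide (i ∈ act k s)) (s' i)
  map_add' p q := by
    ext s'
    simp only [Pi.add_apply, add_mul, Finset.sum_add_distrib]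
  map_smul' c p := by
    ext s'
    simp only [Pi.smul_apply, smul_eq_mul, RingHom.id_apply, Finset.mul_sum, mul_assoc]

/-- The expected reward of one time step, as a function of the law of the joint state. -/
def lawReward : ((Fin N → Bool) → ℝ) →ₗ[ℝ] ℝ where
  toFun p := ∑ s, ∑ k, p s * M.f k * ∑ i, M.r i k (s i) (decide (i ∈ act k s))
  map_add' p q := by
    simp only [Pi.add_apply, add_mul, Finset.sum_add_distrib]
  map_smul' c p := by
    simp only [Pi.smul_apply, smul_eq_mul, RingHom.id_apply, Finset.mul_sum, mul_assoc]

/-- The occupancy measure of a law `p` of the joint state: the joint probability that arm `i` is in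
state `s`, takes the action `a`, and that the context is `k`. -/
def occupancy (p : (Fin N → Bool) → ℝ) (i : Fin N) (s a : Bool) (k : Fin K) : ℝ :=
  ∑ x : Fin N → Bool, if x i = s ∧ decide (i ∈ act k x) = a then p x * M.f k else 0

/-- Sums against an occupancy measure are expectations. All constraints of the linear program and its
objective are instances. -/
theorem sum_occupancy_mul (p : (Fin N → Bool) → ℝ) (i : Fin N) (k : Fin K)
    (g : Bool → Bool → ℝ) :
    ∑ s, ∑ a, g s a * M.occupancy act p i s a k =
      ∑ x, p x * M.f k * g (x i) (decide (i ∈ act k x)) := by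
  simp only [occupancy, Fintype.sum_bool, Finset.mul_sum, ← Finset.sum_add_distrib]
  refine Finset.sum_congr rfl fun x _ => ?_
  cases x i <;> cases decide (i ∈ act k x) <;> simp [mul_comm]

/-- The marginal of a product of probability vectors. -/
theorem sum_ite_prod_eq {p : Fin N → Bool → ℝ} (hp : ∀ j, ∑ y, p j y = 1) (i : Fin N)
    (y : Bool) : ∑ x : Fin N → Bool, (if x i = y then ∏ j, p j (x j) else 0) = p i y := by
  have h := Finset.prod_univ_sum (fun _ : Fin N => (Finset.univ : Finset Bool))
    (fun j z => if j = i ∧ z ≠ y then 0 else p j z)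
  rw [Fintype.piFinset_univ, Finset.prod_eq_single i] at h
  · rw [show (∑ z, if i = i ∧ z ≠ y then 0 else p i z) = p i y by cases y <;> simp] at h
    rw [h]
    refine Finset.sum_congr rfl fun x _ => ?_
    split_ifs with hx
    · refine Finset.prod_congr rfl fun j _ => (if_neg ?_).symm
      rintro ⟨rfl, hne⟩
      exact hne hx
    · symm
      apply Finset.prod_eq_zero (Finset.mem_univ i)
      exact if_pos ⟨rfl, hx⟩
  · intro j _ hj
    simpa [hj] using hp j
  · simp

/-- The marginal law of arm `i` after one step only involves the transition probabilities of arm `i`. -/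
theorem sum_ite_stepLaw (p : (Fin N → Bool) → ℝ) (i : Fin N) (y : Bool) :
    ∑ x, (if x i = y then M.stepLaw act p x else 0) =
      ∑ k, ∑ x, p x * M.f k * M.P i k (x i) (decide (i ∈ act k x)) y := by
  have h : ∀ x', (if x' i = y then M.stepLaw act p x' else 0) = ∑ k, ∑ x, p x * M.f k *
      (if x' i = y then ∏ j, M.P j k (x j) (decide (j ∈ act k x)) (x' j) else 0) := by
    intro x'
    rw [Finset.sum_comm]
    split_ifs
    · rfl
    · simp
  simp only [h]
  rw [Finset.sum_comm]
  refine Finset.sum_congr rfl fun k _ => ?_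
  rw [Finset.sum_comm]
  refine Finset.sum_congr rfl fun x _ => ?_
  rw [← Finset.mul_sum,
    sum_ite_prod_eq (p := fun j z => M.P j k (x j) (decide (j ∈ act k x)) z) fun j => M.P_sum _ _ _ _]

theorem sum_stepLaw (p : (Fin N → Bool) → ℝ) : ∑ x, M.stepLaw act p x = ∑ x, p x := by
  have h : ∀ k x, ∑ x' : Fin N → Bool, ∏ j, M.P j k (x j) (decide (j ∈ act k x)) (x' j) = 1 := by
    intro k x
    have := Finset.prod_univ_sum (fun _ : Fin N => (Finset.univ : Finset Bool))
      (fun j z => M.P j k (x j) (decide (j ∈ act k x)) z)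
    rw [Fintype.piFinset_univ] at this
    rw [← this]
    exact Finset.prod_eq_one fun j _ => M.P_sum _ _ _ _
  change ∑ x', ∑ x, ∑ k, p x * M.f k * _ = _
  rw [Finset.sum_comm]
  refine Finset.sum_congr rfl fun x _ => ?_
  rw [Finset.sum_comm]
  simp only [← Finset.mul_sum, h, mul_one, M.f_sum]

theorem stateLaw_mem_stdSimplex (t : ℕ) :
    M.stateLaw act t ∈ stdSimplex ℝ (Fin N → Bool) := by
  induction t with
  | zero => exact ⟨M.init_nonneg, M.init_sum⟩
  | succ t ih =>
    refine ⟨fun x => Finset.sum_nonneg fun s _ => Finset.sum_nonneg fun k _ => ?_, ?_⟩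
    · exact mul_nonneg (mul_nonneg (ih.1 s) (M.f_pos k).le)
        (Finset.prod_nonneg fun i _ => M.P_nonneg _ _ _ _ _)
    · exact (M.sum_stepLaw act _).trans ih.2

/-- The Cesàro average of the laws of the joint state over the first `T` time steps. -/
def avgLaw (T : ℕ) : (Fin N → Bool) → ℝ :=
  (T : ℝ)⁻¹ • ∑ t ∈ Finset.range T, M.stateLaw act t

theorem avgLaw_mem_stdSimplex {T : ℕ} (hT : T ≠ 0) :
    M.avgLaw act T ∈ stdSimplex ℝ (Fin N → Bool) := by
  have hT' : (T : ℝ) ≠ 0 := by exact_mod_cast hT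
  have h := (convex_stdSimplex ℝ (Fin N → Bool)).sum_mem (t := Finset.range T)
    (w := fun _ => (T : ℝ)⁻¹) (z := M.stateLaw act) (fun _ _ => by positivity)
    (by simp [hT']) (fun t _ => M.stateLaw_mem_stdSimplex act t)
  rwa [← Finset.smul_sum] at h

theorem lawReward_avgLaw (T : ℕ) : M.lawReward act (M.avgLaw act T) =
    (∑ t ∈ Finset.range T, M.stepReward act t) / (T : ℝ) := by
  rw [avgLaw, map_smul, map_sum, smul_eq_mul, inv_mul_eq_div]
  rfl

theorem stepLaw_avgLaw_sub (T : ℕ) : M.stepLaw act (M.avgLaw act T) - M.avgLaw act T =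
    (T : ℝ)⁻¹ • (M.stateLaw act T - M.stateLaw act 0) := by
  rw [avgLaw, map_smul, map_sum, ← smul_sub, ← Finset.sum_sub_distrib]
  congr 1
  exact Finset.sum_range_sub (M.stateLaw act) T

theorem tendsto_stepLaw_avgLaw_sub :
    Tendsto (fun T => M.stepLaw act (M.avgLaw act T) - M.avgLaw act T) atTop (nhds 0) := by
  simp only [stepLaw_avgLaw_sub]
  refine NormedField.tendsto_zero_smul_of_tendsto_zero_of_bounded
    (𝕜 := ℝ) tendsto_inv_atTop_nhds_zero_nat ?_
  obtain ⟨R, hR⟩ := (isCompact_stdSimplex ℝ (Fin N → Bool)).isBounded.exists_norm_le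
  refine isBoundedUnder_of ⟨R + R, fun T => ?_⟩
  exact (norm_sub_le _ _).trans (add_le_add (hR _ (M.stateLaw_mem_stdSimplex act T))
    (hR _ (M.stateLaw_mem_stdSimplex act 0)))

/-- A limit point of the averaged laws along times at which the average reward exceeds `q`. The bound is
stated with `q` below the average reward, so that the limit superior need not be attained along a
subsequence. -/
theorem exists_stationary_lawReward_ge {q : ℝ} (hq : q < M.avgReward act) :
    ∃ p ∈ stdSimplex ℝ (Fin N → Bool), M.stepLaw act p = p ∧ q ≤ M.lawReward act p := by
  have hcont : Continuous (M.lawReward act) := LinearMap.continuous_of_finiteDimensional _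
  have hcontS : Continuous (M.stepLaw act) := LinearMap.continuous_of_finiteDimensional _
  have hcpt := isCompact_stdSimplex ℝ (Fin N → Bool)
  obtain ⟨R, hR⟩ := hcpt.bddBelow_image hcont.continuousOn
  have hbdd : IsCoboundedUnder (· ≤ ·) atTop
      (fun T : ℕ => (∑ t ∈ Finset.range T, M.stepReward act t) / (T : ℝ)) := by
    refine IsBoundedUnder.isCoboundedUnder_le ⟨R, ?_⟩
    rw [eventually_map]
    filter_upwards [eventually_ne_atTop 0] with T hT
    rw [← lawReward_avgLaw]
    exact hR ⟨_, M.avgLaw_mem_stdSimplex act hT, rfl⟩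
  have hfreq := frequently_lt_of_lt_limsup hbdd hq
  have hne := frequently_iff_neBot.1 hfreq
  -- an ultrafilter concentrated on times at which the average reward exceeds `q`
  set F := Ultrafilter.of (atTop ⊓ 𝓟 {T : ℕ | q < (∑ t ∈ Finset.range T, M.stepReward act t) /
    (T : ℝ)}) with hF
  have hle := Ultrafilter.of_le (atTop ⊓ 𝓟 {T : ℕ | q <
    (∑ t ∈ Finset.range T, M.stepReward act t) / (T : ℝ)})
  have hFtop : (F : Filter ℕ) ≤ atTop := hle.trans inf_le_left
  have hFq : ∀ᶠ T in (F : Filter ℕ), q < M.lawReward act (M.avgLaw act T) := by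
    simp only [lawReward_avgLaw]
    exact (hle.trans inf_le_right) (mem_principal_self _)
  have hmem : ∀ᶠ T in (F : Filter ℕ), M.avgLaw act T ∈ stdSimplex ℝ (Fin N → Bool) :=
    hFtop ((eventually_ne_atTop 0).mono fun T hT => M.avgLaw_mem_stdSimplex act hT)
  obtain ⟨p, hp, hlim⟩ := hcpt.ultrafilter_le_nhds (F.map (M.avgLaw act))
    (le_principal_iff.2 hmem)
  have hlim' : Tendsto (M.avgLaw act) F (nhds p) := hlim
  refine ⟨p, hp, ?_, ?_⟩
  · have h0 := (M.tendsto_stepLaw_avgLaw_sub act).mono_left hFtop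
    exact sub_eq_zero.1 (tendsto_nhds_unique
      (((hcontS.tendsto p).comp hlim').sub hlim') h0)
  · exact ge_of_tendsto ((hcont.tendsto p).comp hlim') (hFq.mono fun T hT => hT.le)

/-- The occupancy measure of a stationary law is feasible for the linear program that defines `LP b` if
exactly `b k` arms are pulled in context `k`. -/
theorem lpFeasible_occupancy {p : (Fin N → Bool) → ℝ} (hp : p ∈ stdSimplex ℝ (Fin N → Bool))
    (hstat : M.stepLaw act p = p) (b : M.Alloc) (hcard : ∀ k x, (act k x).card = b.1 k) :
    M.LPFeasible (M.occupancy act p) ∧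
      ∀ k, 1 / M.f k * (∑ i, ∑ s, M.occupancy act p i s true k) = (b.1 k : ℝ) := by
  have hpull : ∀ k, ∑ i, ∑ s, M.occupancy act p i s true k = M.f k * b.1 k := by
    intro k
    have h : ∀ i, ∑ s, M.occupancy act p i s true k =
        ∑ x, p x * M.f k * (if i ∈ act k x then 1 else 0) := by
      intro i
      have := M.sum_occupancy_mul act p i k fun _ a => if a then 1 else 0
      simpa using this
    simp only [h]
    rw [Finset.sum_comm]
    simp only [← Finset.mul_sum, Finset.sum_boole, Finset.filter_mem_eq_inter, Finset.univ_inter,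
      hcard, ← Finset.sum_mul, hp.2, one_mul]
  refine ⟨⟨?_, ?_, ?_, ?_⟩, ?_⟩
  · intro k' s' i
    have h1 := M.sum_ite_stepLaw act p i s'
    rw [hstat] at h1
    simp only [M.sum_occupancy_mul act p i _ fun s a => M.P i _ s a s']
    rw [← h1]
    have h2 := M.sum_occupancy_mul act p i k' fun s _ => if s = s' then 1 else 0
    simp only [ite_mul, one_mul, zero_mul, mul_ite, mul_one, mul_zero] at h2
    rw [Finset.mul_sum]
    trans ∑ x, if x i = s' then p x * M.f k' else 0
    · exact Finset.sum_congr rfl fun x _ => by split_ifs <;> ring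
    · rw [← h2]
      cases s' <;> simp
  · intro i
    have h : ∀ k, ∑ a, ∑ s, M.occupancy act p i s a k = M.f k := by
      intro k
      rw [Finset.sum_comm]
      have := M.sum_occupancy_mul act p i k fun _ _ => 1
      simpa only [one_mul, mul_one, ← Finset.sum_mul, hp.2] using this
    simp only [h, M.f_sum]
  · simp only [hpull]
    exact b.2
  · intro i s a k
    refine Finset.sum_nonneg fun x _ => ?_
    split_ifs
    · exact mul_nonneg (hp.1 x) (M.f_pos k).le
    · exact le_rfl
  · intro k
    rw [hpull, one_div, inv_mul_cancel_left₀ (M.f_pos k).ne']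

theorem lpObjective_occupancy (p : (Fin N → Bool) → ℝ) :
    M.lpObjective (M.occupancy act p) = M.lawReward act p := by
  have h : ∀ i k, ∑ s, ∑ a, M.occupancy act p i s a k * M.r i k s a =
      ∑ x, p x * M.f k * M.r i k (x i) (decide (i ∈ act k x)) := by
    intro i k
    rw [← M.sum_occupancy_mul act p i k fun s a => M.r i k s a]
    simp only [mul_comm]
  change ∑ i, ∑ k, _ = ∑ x, ∑ k, _
  simp only [h, Finset.mul_sum]
  rw [Finset.sum_comm]
  conv_rhs => rw [Finset.sum_comm]
  exact Finset.sum_congr rfl fun k _ => Finset.sum_comm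

theorem avgReward_le_LP (b : M.Alloc) (hcard : ∀ k x, (act k x).card = b.1 k) :
    (M.avgReward act : EReal) ≤ M.LP b := by
  by_contra! hlt
  obtain ⟨q, hq1, hq2⟩ := EReal.lt_iff_exists_real_btwn.1 hlt
  obtain ⟨p, hp, hstat, hq⟩ := M.exists_stationary_lawReward_ge act (EReal.coe_lt_coe_iff.1 hq2)
  obtain ⟨hfeas, hbud⟩ := M.lpFeasible_occupancy act hp hstat b hcard
  refine absurd hq1 (not_lt.2 (le_trans (EReal.coe_le_coe_iff.2 hq) ?_))
  rw [← lpObjective_occupancy]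
  exact le_sSup ⟨_, hfeas, hbud, rfl⟩

end OccupancyBound

variable {M} in
/-- An optimal allocation truncated at `N` in every context gives the same policy, so it is optimal too,
and it pulls exactly as many arms as its budgets allow. -/
theorem exists_optimal_le_LP {μ : Fin N → Bool → Bool → Fin K → ℝ}
    {sel : Fin K → ℕ → (Fin N → Bool) → Finset (Fin N)} (hsel : M.IsIndexRule μ sel) :
    ∃ b : M.Alloc, M.gap sel b = 0 ∧ (M.reward sel b : EReal) ≤ M.LP b := by
  obtain ⟨b, -, hb⟩ := Finset.exists_mem_eq_sup' (Finset.univ_nonempty (α := M.Alloc))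
    (M.reward sel)
  have hle : ∀ k, ((min (b.1 k) N : ℕ) : ℝ) ≤ b.1 k := fun k => by
    exact_mod_cast min_le_left _ _
  let b' : M.Alloc := ⟨fun k => min (b.1 k) N, le_trans (Finset.sum_le_sum fun k _ =>
    mul_le_mul_of_nonneg_left (hle k) (M.f_pos k).le) b.2⟩
  -- with a budget of at least `N` all arms are pulled, whatever the tie-breaking rule
  have huniv : ∀ k n s, N ≤ n → sel k n s = Finset.univ := fun k n s hn =>
    Finset.eq_univ_of_card _ (by rw [(hsel k n s).1, min_eq_right hn, Fintype.card_fin])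
  have hact : (fun k => sel k (b'.1 k)) = fun k => sel k (b.1 k) := by
    funext k s
    change sel k (min (b.1 k) N) s = _
    rcases le_total (b.1 k) N with h | h
    · rw [min_eq_left h]
    · rw [min_eq_right h, huniv k N s le_rfl, huniv k _ s h]
  refine ⟨b', ?_, M.avgReward_le_LP _ b' fun k x => ?_⟩
  · rw [gap, hb, sub_eq_zero, reward, reward, hact]
  · rw [(hsel k _ x).1]
    exact min_eq_left (min_le_right _ _)

theorem gap_nonneg (sel : Fin K → ℕ → (Fin N → Bool) → Finset (Fin N)) (b : M.Alloc) :
    0 ≤ M.gap sel b :=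
  sub_nonneg.2 (Finset.le_sup' (M.reward sel) (Finset.mem_univ b))

end CBB

/-! ### Counting the pulls of a suboptimal allocation -/

section Counting

variable {Ω ι : Type*}

theorem natCast_card_filter_eq_sum_indicator (s : Finset ι) (p : ι → Ω → Prop)
    [∀ ω, DecidablePred fun i => p i ω] (ω : Ω) :
    (((s.filter fun i => p i ω).card : ℕ) : ℝ) =
      ∑ i ∈ s, Set.indicator {ω | p i ω} (fun _ => (1 : ℝ)) ω := by
  classical
  rw [Finset.card_filter]
  push_cast
  refine Finset.sum_congr rfl fun i _ => ?_
  simp [Set.indicator_apply]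

variable [MeasurableSpace Ω] {Pr : Measure Ω} [IsFiniteMeasure Pr]

theorem integrable_indicator_one {E : Set Ω} (hE : MeasurableSet E) :
    Integrable (E.indicator fun _ => (1 : ℝ)) Pr :=
  (integrable_const 1).indicator hE

theorem integrable_card_filter (s : Finset ι) {p : ι → Ω → Prop}
    [∀ ω, DecidablePred fun i => p i ω] (hp : ∀ i, MeasurableSet {ω | p i ω}) :
    Integrable (fun ω => (((s.filter fun i => p i ω).card : ℕ) : ℝ)) Pr := by
  simp only [natCast_card_filter_eq_sum_indicator]
  exact integrable_finsetSum _ fun i _ => integrable_indicator_one (hp i)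

theorem integral_card_filter (s : Finset ι) {p : ι → Ω → Prop}
    [∀ ω, DecidablePred fun i => p i ω] (hp : ∀ i, MeasurableSet {ω | p i ω}) :
    ∫ ω, (((s.filter fun i => p i ω).card : ℕ) : ℝ) ∂Pr = ∑ i ∈ s, Pr.real {ω | p i ω} := by
  simp only [natCast_card_filter_eq_sum_indicator]
  rw [integral_finsetSum _ fun i _ => integrable_indicator_one (hp i)]
  refine Finset.sum_congr rfl fun i _ => ?_
  exact integral_indicator_one (hp i)

end Counting

namespace CBB

variable {N K : ℕ} {M : CBB N K}

section Pulls

variable {arm : ℕ → M.Alloc} {b : M.Alloc}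

theorem pulls_mono : Monotone fun t => M.pulls arm t b := fun _ _ h =>
  Finset.card_le_card (Finset.filter_subset_filter _ (Finset.range_mono h))

theorem pulls_lt_pulls {s t : ℕ} (h : s < t) (hs : arm s = b) :
    M.pulls arm s b < M.pulls arm t b := by
  refine lt_of_lt_of_le ?_ (pulls_mono (Nat.succ_le_of_lt h))
  simp only [pulls]
  rw [Nat.succ_eq_add_one, Finset.range_add_one, Finset.filter_insert, if_pos hs,
    Finset.card_insert_of_notMem (by simp)]
  exact Nat.lt_succ_self _

theorem pulls_le (t : ℕ) : M.pulls arm t b ≤ t :=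
  (Finset.card_filter_le _ _).trans (Finset.card_range t).le

theorem pulls_pos_iff {t : ℕ} : 0 < M.pulls arm t b ↔ b ∈ M.pulled arm t := by
  simp [pulls, pulled, Finset.card_pos, Finset.Nonempty]

end Pulls

section Regret

variable {sel : Fin K → ℕ → (Fin N → Bool) → Finset (Fin N)} {c : ℝ} {x : M.Alloc → ℕ → ℝ}
  {arm : ℕ → M.Alloc}

theorem regret_eq_sum_pulled (T : ℕ) : M.regret sel arm T =
    ∑ b ∈ M.pulled arm T, (M.pulls arm T b : ℝ) * M.gap sel b := by
  simp only [regret, pulled, pulls, ← nsmul_eq_mul]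
  exact Finset.sum_comp (M.gap sel) arm

theorem regret_eq_sum (T : ℕ) : M.regret sel arm T =
    ∑ b, (M.pulls arm T b : ℝ) * M.gap sel b := by
  rw [regret_eq_sum_pulled]
  refine Finset.sum_subset (Finset.subset_univ _) fun b _ hb => ?_
  rw [← pulls_pos_iff, not_lt, Nat.le_zero] at hb
  rw [hb, Nat.cast_zero, zero_mul]

/-- The upper confidence bound of the allocation `b` lies above its mean for every number of pulls
that is possible after `t` rounds. -/
def IsConfident (M : CBB N K) (sel : Fin K → ℕ → (Fin N → Bool) → Finset (Fin N)) (c : ℝ)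
    (x : M.Alloc → ℕ → ℝ) (b : M.Alloc) (t : ℕ) : Prop :=
  ∀ s ∈ Finset.Icc 1 t,
    ∑ i ∈ Finset.range s, (M.reward sel b - x b i) < c * Real.sqrt (s * Real.log t)

theorem sqrt_mul_eq_mul_sqrt_div {s L : ℝ} (hs : 0 < s) :
    Real.sqrt (s * L) = s * Real.sqrt (L / s) := by
  rw [show s * L = s ^ 2 * (L / s) by field_simp, Real.sqrt_mul (by positivity),
    Real.sqrt_sq hs.le]

theorem IsConfident.reward_le_ucbIndex {b : M.Alloc} {t : ℕ} (h : M.IsConfident sel c x b t)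
    (hb : b ∈ M.pulled arm t) : M.reward sel b ≤ M.ucbIndex c x arm t b := by
  have hpos := pulls_pos_iff.2 hb
  have hs : (0 : ℝ) < M.pulls arm t b := by exact_mod_cast hpos
  have h1 := h _ (Finset.mem_Icc.2 ⟨hpos, pulls_le t⟩)
  rw [sqrt_mul_eq_mul_sqrt_div hs, Finset.sum_sub_distrib, Finset.sum_const, Finset.card_range,
    nsmul_eq_mul] at h1
  rw [ucbIndex, empMean, ← sub_le_iff_le_add, le_div_iff₀ hs]
  linarith

/-- A repeatedly pulled allocation has an index above the optimal mean as long as the optimal allocation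
is confident: the index beats the upper confidence bound of the optimal allocation if that is a
standard arm, and the index of the TreeArm, which is at least `LP bopt`, if it is not. -/
theorem reward_le_ucbIndex_arm (hrun : M.IsMitosisRun c x arm) {bopt : M.Alloc}
    (hLP : (M.reward sel bopt : EReal) ≤ M.LP bopt) {t : ℕ} (ht : arm t ∈ M.pulled arm t)
    (hconf : M.IsConfident sel c x bopt t) :
    M.reward sel bopt ≤ M.ucbIndex c x arm t (arm t) := by
  rcases hrun t with ⟨-, hstd, htree⟩ | ⟨-, hmem, -⟩
  · by_cases hb : bopt ∈ M.pulled arm t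
    · exact (hconf.reward_le_ucbIndex hb).trans (hstd _ hb)
    · have hb' : bopt ∈ M.tree arm t := Finset.mem_sdiff.2 ⟨Finset.mem_univ _, hb⟩
      exact EReal.coe_le_coe_iff.1 (hLP.trans ((Finset.le_sup (f := M.LP) hb').trans htree))
  · exact absurd ht (Finset.mem_sdiff.1 hmem).2

open Classical in
/-- The rounds in which the optimal allocation is not confident are counted by `t`, the others by the
number of pulls of `b` so far, which is different in different rounds; the final `1` is the first
pull. -/
theorem pulls_le_card_add_card (hc : 0 < c) (hrun : M.IsMitosisRun c x arm) {bopt : M.Alloc}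
    (hopt : M.gap sel bopt = 0) (hLP : (M.reward sel bopt : EReal) ≤ M.LP bopt) (b : M.Alloc)
    (T : ℕ) :
    M.pulls arm T b ≤ ((Finset.Ico 1 T).filter fun t => ¬ M.IsConfident sel c x bopt t).card +
      (((Finset.Icc 1 T).filter fun s : ℕ => M.gap sel b ≤
        (∑ i ∈ Finset.range s, (x b i - M.reward sel b)) / s +
          c * Real.sqrt (Real.log T / s)).card + 1) := by
  set F := (Finset.Icc 1 T).filter fun s : ℕ => M.gap sel b ≤
        (∑ i ∈ Finset.range s, (x b i - M.reward sel b)) / s +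
          c * Real.sqrt (Real.log T / s) with hF
  set S := (Finset.range T).filter fun t => arm t = b with hS
  have hbad : (S.filter fun t => ¬ M.IsConfident sel c x bopt t) ⊆
      (Finset.Ico 1 T).filter fun t => ¬ M.IsConfident sel c x bopt t := by
    intro t ht
    simp only [hS, Finset.mem_filter, Finset.mem_range] at ht
    refine Finset.mem_filter.2 ⟨Finset.mem_Ico.2 ⟨Nat.one_le_iff_ne_zero.2 ?_, ht.1.1⟩, ht.2⟩
    -- at `t = 0` there is no number of pulls to check, so confidence holds vacuously
    rintro rfl
    exact ht.2 fun s hs => by simp at hs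
  -- different rounds with a pull of `b` have different numbers of earlier pulls of `b`
  have hgood : (S.filter fun t => M.IsConfident sel c x bopt t).card ≤ (insert 0 F).card := by
    refine Finset.card_le_card_of_injOn (fun t => M.pulls arm t b) ?_ ?_
    · intro t ht
      simp only [hS, Finset.coe_filter, Finset.mem_filter, Finset.mem_range,
        Set.mem_ofPred_eq] at ht
      obtain ⟨⟨htT, rfl⟩, hconf⟩ := ht
      rw [Finset.mem_coe, Finset.mem_insert]
      refine (Nat.eq_zero_or_pos _).imp_right fun hpos => ?_
      have hs : (0 : ℝ) < M.pulls arm t (arm t) := by exact_mod_cast hpos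
      have ht0 : 0 < t := hpos.trans_le (pulls_le t)
      have hucb := reward_le_ucbIndex_arm hrun hLP (pulls_pos_iff.1 hpos) hconf
      have hlog : Real.log t ≤ Real.log T :=
        Real.log_le_log (by exact_mod_cast ht0) (by exact_mod_cast htT.le)
      have hsqrt : c * Real.sqrt (Real.log t / M.pulls arm t (arm t)) ≤
          c * Real.sqrt (Real.log T / M.pulls arm t (arm t)) := by gcongr
      refine Finset.mem_filter.2 ⟨Finset.mem_Icc.2 ⟨hpos, (pulls_le t).trans htT.le⟩, ?_⟩
      rw [Finset.sum_sub_distrib, Finset.sum_const, Finset.card_range, nsmul_eq_mul, sub_div,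
        mul_div_cancel_left₀ _ hs.ne']
      rw [ucbIndex, empMean] at hucb
      simp only [gap] at hopt ⊢
      linarith
    · intro t ht t' ht' heq
      have hS_of : ∀ u ∈ S.filter (fun t => M.IsConfident sel c x bopt t), arm u = b :=
        fun u hu => (Finset.mem_filter.1 (Finset.mem_filter.1 hu).1).2
      rcases lt_trichotomy t t' with h | h | h
      · exact absurd heq (pulls_lt_pulls h (hS_of t ht)).ne
      · exact h
      · exact absurd heq (pulls_lt_pulls h (hS_of t' ht')).ne'
  calc M.pulls arm T b = (S.filter fun t => M.IsConfident sel c x bopt t).card +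
        (S.filter fun t => ¬ M.IsConfident sel c x bopt t).card := by
        rw [Finset.card_filter_add_card_filter_not]; rfl
    _ ≤ (insert 0 F).card + _ := add_le_add hgood (Finset.card_le_card hbad)
    _ ≤ _ := by
      rw [add_comm]
      exact Nat.add_le_add_left (Finset.card_insert_le _ _) _

end Regret

section Expectation

variable {sel : Fin K → ℕ → (Fin N → Bool) → Finset (Fin N)} {Ω : Type*} [MeasurableSpace Ω]
  {Pr : Measure Ω} {arm : ℕ → Ω → M.Alloc}

theorem measurableSet_arm_eq (harm : ∀ t, Measurable (arm t)) (b : M.Alloc) (t : ℕ) :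
    MeasurableSet {ω | arm t ω = b} :=
  harm t (measurableSet_singleton b)

theorem measurableSet_mem_pulled (harm : ∀ t, Measurable (arm t)) (b : M.Alloc) (T : ℕ) :
    MeasurableSet {ω | b ∈ M.pulled (fun t => arm t ω) T} := by
  have : {ω | b ∈ M.pulled (fun t => arm t ω) T} =
      ⋃ t ∈ Finset.range T, {ω | arm t ω = b} := by
    ext ω
    simp [pulled]
  rw [this]
  exact Finset.measurableSet_biUnion _ fun t _ => measurableSet_arm_eq harm b t

theorem integrable_pulls [IsProbabilityMeasure Pr] (harm : ∀ t, Measurable (arm t)) (T : ℕ)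
    (b : M.Alloc) :
    Integrable (fun ω => (M.pulls (fun t => arm t ω) T b : ℝ)) Pr :=
  integrable_card_filter (Finset.range T) (measurableSet_arm_eq harm b)

theorem integral_pulls_eq_zero {T : ℕ} {b : M.Alloc}
    (h : ¬ 0 < Pr {ω | b ∈ M.pulled (fun t => arm t ω) T}) :
    ∫ ω, (M.pulls (fun t => arm t ω) T b : ℝ) ∂Pr = 0 := by
  refine integral_eq_zero_of_ae ?_
  have h0 : ∀ᵐ ω ∂Pr, b ∉ M.pulled (fun t => arm t ω) T := by
    rw [ae_iff]
    simpa using h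
  filter_upwards [h0] with ω hω
  rw [← pulls_pos_iff, not_lt, Nat.le_zero] at hω
  simp [hω]

theorem integral_regret_eq_sum [IsProbabilityMeasure Pr] (harm : ∀ t, Measurable (arm t)) (T : ℕ) :
    ∫ ω, M.regret sel (fun t => arm t ω) T ∂Pr =
      ∑ b, (∫ ω, (M.pulls (fun t => arm t ω) T b : ℝ) ∂Pr) * M.gap sel b := by
  simp only [regret_eq_sum]
  rw [integral_finsetSum _ fun b _ => (integrable_pulls harm T b).mul_const _]
  simp only [integral_mul_const]

namespace IsFastOracle

variable {σ : NNReal} {X : M.Alloc → ℕ → Ω → ℝ}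

theorem iIndepFun_arm (hX : M.IsFastOracle sel Pr σ X) (b : M.Alloc) :
    iIndepFun (fun n => X b n) Pr :=
  hX.indep.precomp (g := fun n => (b, n)) fun _ _ h => (Prod.mk.inj h).2

theorem hasSubgaussianMGF_of_le (hX : M.IsFastOracle sel Pr σ X) {v : NNReal} (hv : σ ^ 2 ≤ v)
    (b : M.Alloc) (n : ℕ) : HasSubgaussianMGF (fun ω => X b n ω - M.reward sel b) v Pr where
  integrable_exp_mul := (hX.subG b n).integrable_exp_mul
  mgf_le t := ((hX.subG b n).mgf_le t).trans (by
    have : ((σ ^ 2 : NNReal) : ℝ) ≤ v := by exact_mod_cast hv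
    gcongr)

theorem integral_reward_sub [IsProbabilityMeasure Pr] (hX : M.IsFastOracle sel Pr σ X)
    (b : M.Alloc) (n : ℕ) :
    ∫ ω, (M.reward sel b - X b n ω) ∂Pr = 0 := by
  have hint : Integrable (X b n) Pr := by
    have h := (hX.subG b n).integrable.add (integrable_const (M.reward sel b))
    refine h.congr (ae_of_all _ fun ω => ?_)
    simp
  rw [integral_sub (integrable_const _) hint, hX.mean]
  simp

end IsFastOracle

/-- The expected number of pulls of a suboptimal allocation. The variance proxy `v` may exceed `σ ^ 2`,
which makes room for `σ = 0`. -/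
theorem integral_pulls_le [IsProbabilityMeasure Pr] {σ v : NNReal} {X : M.Alloc → ℕ → Ω → ℝ}
    {c β : ℝ} (hX : M.IsFastOracle sel Pr σ X) (hσv : σ ^ 2 ≤ v) (hv : 0 < v) (hc : 0 < c) (hβ : 1 < β)
    (hγ : 1 < c ^ 2 / (2 * v * β)) (harm : ∀ t, Measurable (arm t))
    (hrun : ∀ ω, M.IsMitosisRun c (fun b n => X b n ω) (fun t => arm t ω)) {bopt : M.Alloc}
    (hopt : M.gap sel bopt = 0) (hLP : (M.reward sel bopt : EReal) ≤ M.LP bopt) {b : M.Alloc}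
    (hb : 0 < M.gap sel b) (T : ℕ) :
    ∫ ω, (M.pulls (fun t => arm t ω) T b : ℝ) ∂Pr ≤
      (∑' t : ℕ, (1 + Real.log t / Real.log β) * (t : ℝ) ^ (-(c ^ 2 / (2 * v * β)))) +
        (4 * c ^ 2 * Real.log T / M.gap sel b ^ 2 + 8 * v / M.gap sel b ^ 2 + 1) := by
  classical
  set Δ := M.gap sel b with hΔ
  have hbad_eq : ∀ t, {ω | ¬ M.IsConfident sel c (fun b n => X b n ω) bopt t} =
      {ω | ∃ s ∈ Finset.Icc 1 t, c * Real.sqrt (s * Real.log t) ≤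
        ∑ i ∈ Finset.range s, (M.reward sel bopt - X bopt i ω)} := by
    intro t
    ext ω
    simp [IsConfident, and_assoc]
  have hbad_meas : ∀ t, MeasurableSet
      {ω | ¬ M.IsConfident sel c (fun b n => X b n ω) bopt t} := by
    intro t
    have : {ω | ¬ M.IsConfident sel c (fun b n => X b n ω) bopt t} =
        ⋃ s ∈ Finset.Icc 1 t, {ω | c * Real.sqrt (s * Real.log t) ≤
          ∑ i ∈ Finset.range s, (M.reward sel bopt - X bopt i ω)} := by
      rw [hbad_eq]
      ext ω
      simp
    rw [this]
    exact Finset.measurableSet_biUnion _ fun s _ => measurableSet_le measurable_const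
      (Finset.measurable_fun_sum _ fun i _ => (hX.meas bopt i).const_sub _)
  have hF_meas : ∀ s : ℕ, MeasurableSet {ω | Δ ≤
      (∑ i ∈ Finset.range s, (X b i ω - M.reward sel b)) / s +
        c * Real.sqrt (Real.log T / s)} := fun s =>
    measurableSet_le measurable_const (((Finset.measurable_fun_sum _ fun i _ =>
      (hX.meas b i).sub_const _).div_const _).add_const _)
  have hmono := integral_mono (μ := Pr) (integrable_pulls harm T b)
    ((integrable_card_filter (Finset.Ico 1 T) hbad_meas).add
      ((integrable_card_filter (Finset.Icc 1 T) hF_meas).add (integrable_const (1 : ℝ))))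
    (fun ω => by
      have h := pulls_le_card_add_card hc (hrun ω) hopt hLP b T
      have h' : (M.pulls (fun t => arm t ω) T b : ℝ) ≤ _ := Nat.cast_le.2 h
      push_cast at h'
      convert! h')
  refine hmono.trans ?_
  rw [integral_add' (integrable_card_filter _ hbad_meas)
    ((integrable_card_filter _ hF_meas).add (integrable_const _)),
    integral_card_filter _ hbad_meas, integral_add' (integrable_card_filter _ hF_meas) (integrable_const _),
    integral_card_filter _ hF_meas]
  have hindep : iIndepFun (fun n ω => M.reward sel bopt - X bopt n ω) Pr :=
    (hX.iIndepFun_arm bopt).comp (fun _ y => M.reward sel bopt - y)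
      fun _ => measurable_id.const_sub _
  have hindepF : iIndepFun (fun n ω => X b n ω - M.reward sel b) Pr :=
    (hX.iIndepFun_arm b).comp (fun _ y => y - M.reward sel b)
      fun _ => measurable_id.sub_const _
  have hsubG : ∀ n, HasSubgaussianMGF (fun ω => M.reward sel bopt - X bopt n ω) v Pr := by
    intro n
    have := (hX.hasSubgaussianMGF_of_le hσv bopt n).neg
    convert! this using 1
    ext ω
    simp
  refine add_le_add ?_ (add_le_add ?_ (by simp))
  · refine le_trans (Finset.sum_le_sum fun t ht => ?_)
      (Summable.sum_le_tsum (Finset.Ico 1 T) (fun t _ => ?_) (summable_log_mul_rpow hγ))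
    · rw [hbad_eq]
      exact measureReal_exists_sqrt_log_le_sum_le
        (fun n => (hX.meas bopt n).const_sub _) hindep hsubG (hX.integral_reward_sub bopt) hv hc hβ
        (Finset.mem_Ico.1 ht).1
    · have h1 := Real.log_natCast_nonneg t
      have h2 := Real.log_pos hβ
      positivity
  · exact sum_measureReal_le_average_add_bonus_le hindepF (hX.hasSubgaussianMGF_of_le hσv b) hv hc
      hb T

/-- The sets of pulled allocations increase with `T`, so the finitely many probabilities that ever
become positive are eventually bounded below. -/
theorem exists_le_measureReal_mem_pulled [IsProbabilityMeasure Pr] (arm : ℕ → Ω → M.Alloc) :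
    ∃ κ : ℝ, 0 < κ ∧ ∀ᶠ T in atTop, ∀ b, 0 < Pr {ω | b ∈ M.pulled (fun t => arm t ω) T} →
      κ ≤ Pr.real {ω | b ∈ M.pulled (fun t => arm t ω) T} := by
  have h : ∀ b : M.Alloc, ∃ κ : ℝ, 0 < κ ∧ ∀ᶠ T in atTop,
      0 < Pr {ω | b ∈ M.pulled (fun t => arm t ω) T} →
        κ ≤ Pr.real {ω | b ∈ M.pulled (fun t => arm t ω) T} := by
    intro b
    by_cases hb : ∃ T, 0 < Pr {ω | b ∈ M.pulled (fun t => arm t ω) T}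
    · obtain ⟨T₀, hT₀⟩ := hb
      refine ⟨Pr.real {ω | b ∈ M.pulled (fun t => arm t ω) T₀},
        ENNReal.toReal_pos hT₀.ne' (measure_ne_top _ _), ?_⟩
      filter_upwards [eventually_ge_atTop T₀] with T hT _
      exact measureReal_mono (fun ω hω =>
        Finset.image_subset_image (Finset.range_mono hT) hω) (measure_ne_top _ _)
    · exact ⟨1, one_pos, Eventually.of_forall fun T hT => absurd ⟨T, hT⟩ hb⟩
  choose κ hκ hev using h
  refine ⟨Finset.univ.inf' Finset.univ_nonempty κ, (Finset.lt_inf'_iff _).2 fun b _ => hκ b, ?_⟩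
  filter_upwards [eventually_all.2 hev] with T hT b hb
  exact (Finset.inf'_le κ (Finset.mem_univ b)).trans (hT b hb)

theorem integral_sum_pulled_filter [IsProbabilityMeasure Pr] (harm : ∀ t, Measurable (arm t))
    (g : M.Alloc → ℝ) (T : ℕ) :
    ∫ ω, (∑ b ∈ M.pulled (fun t => arm t ω) T with 0 < M.gap sel b, g b) ∂Pr =
      ∑ b, if 0 < M.gap sel b then
        Pr.real {ω | b ∈ M.pulled (fun t => arm t ω) T} * g b else 0 := by
  have h : ∀ ω, (∑ b ∈ M.pulled (fun t => arm t ω) T with 0 < M.gap sel b, g b) =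
      ∑ b, Set.indicator {ω | b ∈ M.pulled (fun t => arm t ω) T} (fun _ => (1 : ℝ)) ω *
        (if 0 < M.gap sel b then g b else 0) := by
    intro ω
    rw [Finset.sum_filter, ← Finset.sum_subset (Finset.subset_univ (M.pulled _ T))]
    · refine Finset.sum_congr rfl fun b hb => ?_
      rw [Set.indicator_of_mem (by exact hb), one_mul]
    · intro b _ hb
      rw [Set.indicator_of_notMem (by exact hb), zero_mul]
  simp only [h]
  rw [integral_finsetSum _ fun b _ =>
    (integrable_indicator_one (measurableSet_mem_pulled harm b T)).mul_const _]
  refine Finset.sum_congr rfl fun b _ => ?_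
  rw [integral_mul_const, mul_ite, mul_zero]
  congr 2
  exact integral_indicator_one (measurableSet_mem_pulled harm b T)

end Expectation

end CBB

/-! ### Summing the regret over the allocations -/

namespace CBB

/-- A positive variance proxy and a ratio for the peeling that leave the exponent above `1`. -/
theorem exists_variance_and_ratio {σ : NNReal} {c : ℝ} (hσ : 2 * (σ : ℝ) ^ 2 < c ^ 2) :
    ∃ (v : NNReal) (β : ℝ), σ ^ 2 ≤ v ∧ 0 < v ∧ 1 < β ∧ 1 < c ^ 2 / (2 * v * β) := by
  obtain ⟨w, hw1, hw2⟩ := exists_between hσ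
  have hw0 : 0 < w := lt_of_le_of_lt (by positivity) hw1
  have hα : 1 < c ^ 2 / w := (one_lt_div hw0).2 hw2
  obtain ⟨β, hβ1, hβ2⟩ := exists_between hα
  have hv : ((w / 2).toNNReal : ℝ) = w / 2 := Real.coe_toNNReal _ (by positivity)
  refine ⟨(w / 2).toNNReal, β, ?_, ?_, hβ1, ?_⟩
  · rw [← NNReal.coe_le_coe, hv]
    push_cast
    linarith
  · rw [← NNReal.coe_pos, hv]
    positivity
  · rw [hv, mul_div_cancel₀ w two_ne_zero, ← div_div]
    exact (one_lt_div (by linarith)).2 hβ2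

/-- The terms that do not grow with `T` are absorbed into `L / Δ`, using `Δ ≤ D` and `log 2 ≤ L`. -/
theorem mul_gap_le {n A c v D Δ L : ℝ} (hA : 0 ≤ A) (hv : 0 ≤ v) (hΔ : 0 < Δ) (hΔD : Δ ≤ D)
    (hL : Real.log 2 ≤ L) (hn : n ≤ A + (4 * c ^ 2 * L / Δ ^ 2 + 8 * v / Δ ^ 2 + 1)) :
    n * Δ ≤ ((A + 1) * D ^ 2 / Real.log 2 + 4 * c ^ 2 + 8 * v / Real.log 2) * (L / Δ) := by
  have hlog2 : 0 < Real.log 2 := Real.log_pos one_lt_two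
  have hratio : 1 ≤ L / Real.log 2 := (one_le_div hlog2).2 hL
  have h1 : Δ ^ 2 ≤ D ^ 2 * (L / Real.log 2) :=
    (pow_le_pow_left₀ hΔ.le hΔD 2).trans (le_mul_of_one_le_right (by positivity) hratio)
  have h2 : v ≤ v * (L / Real.log 2) := le_mul_of_one_le_right hv hratio
  rw [← mul_div_assoc, le_div_iff₀ hΔ]
  calc n * Δ * Δ = n * Δ ^ 2 := by ring
    _ ≤ (A + (4 * c ^ 2 * L / Δ ^ 2 + 8 * v / Δ ^ 2 + 1)) * Δ ^ 2 := by gcongr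
    _ = (A + 1) * Δ ^ 2 + 4 * c ^ 2 * L + 8 * v := by field_simp; ring
    _ ≤ (A + 1) * (D ^ 2 * (L / Real.log 2)) + 4 * c ^ 2 * L + 8 * (v * (L / Real.log 2)) := by
      gcongr
    _ = _ := by ring

variable {N K : ℕ} {M : CBB N K}
  {sel : Fin K → ℕ → (Fin N → Bool) → Finset (Fin N)} {Ω : Type*} [MeasurableSpace Ω]
  {Pr : Measure Ω} {arm : ℕ → Ω → M.Alloc}

theorem integral_regret_eq_sum_filter [IsProbabilityMeasure Pr]
    (harm : ∀ t, Measurable (arm t)) (T : ℕ) :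
    ∫ ω, M.regret sel (fun t => arm t ω) T ∂Pr =
      ∑ b with 0 < Pr {ω | b ∈ M.pulled (fun t => arm t ω) T},
        (∫ ω, (M.pulls (fun t => arm t ω) T b : ℝ) ∂Pr) * M.gap sel b := by
  rw [integral_regret_eq_sum harm, Finset.sum_filter]
  refine Finset.sum_congr rfl fun b _ => ?_
  split_ifs with h
  · rfl
  · rw [integral_pulls_eq_zero h, zero_mul]

theorem integral_regret_nonneg (T : ℕ) : 0 ≤ ∫ ω, M.regret sel (fun t => arm t ω) T ∂Pr :=
  integral_nonneg fun _ => Finset.sum_nonneg fun _ _ => M.gap_nonneg sel _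

theorem integral_regret_le [IsProbabilityMeasure Pr] {C : ℝ} (harm : ∀ t, Measurable (arm t))
    {T : ℕ}
    (h : ∀ b, 0 < M.gap sel b → (∫ ω, (M.pulls (fun t => arm t ω) T b : ℝ) ∂Pr) * M.gap sel b ≤
      C * (Real.log T / M.gap sel b)) :
    ∫ ω, M.regret sel (fun t => arm t ω) T ∂Pr ≤
      C * ∑ b with 0 < Pr {ω | b ∈ M.pulled (fun t => arm t ω) T} ∧ 0 < M.gap sel b,
        Real.log T / M.gap sel b := by
  rw [integral_regret_eq_sum_filter harm, ← Finset.filter_filter, Finset.mul_sum]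
  rw [← Finset.sum_filter_of_ne (p := fun b => 0 < M.gap sel b)]
  · exact Finset.sum_le_sum fun b hb => h b (Finset.mem_filter.1 hb).2
  · intro b _ hne
    exact lt_of_le_of_ne (M.gap_nonneg sel b) fun h0 => hne (by rw [← h0, mul_zero])

theorem isBigO_integral_sum_pulled [IsProbabilityMeasure Pr] (harm : ∀ t, Measurable (arm t))
    {C : ℝ} (hC : 0 ≤ C)
    (h : ∀ T : ℕ, 2 ≤ T → ∫ ω, M.regret sel (fun t => arm t ω) T ∂Pr ≤
      C * ∑ b with 0 < Pr {ω | b ∈ M.pulled (fun t => arm t ω) T} ∧ 0 < M.gap sel b,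
        Real.log T / M.gap sel b) :
    (fun T : ℕ => ∫ ω, M.regret sel (fun t => arm t ω) T ∂Pr) =O[atTop]
      (fun T : ℕ => ∫ ω, (∑ b ∈ M.pulled (fun t => arm t ω) T with 0 < M.gap sel b,
        Real.log T / M.gap sel b) ∂Pr) := by
  obtain ⟨κ, hκ, hev⟩ := exists_le_measureReal_mem_pulled (Pr := Pr) arm
  refine Asymptotics.IsBigO.of_bound (C / κ) ?_
  filter_upwards [hev, eventually_ge_atTop 2] with T hT hT2
  rw [Real.norm_of_nonneg (integral_regret_nonneg T)]
  refine ((h T hT2).trans ?_).trans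
    (mul_le_mul_of_nonneg_left (Real.le_norm_self _) (by positivity))
  rw [div_mul_eq_mul_div, mul_div_assoc]
  refine mul_le_mul_of_nonneg_left ?_ hC
  rw [le_div_iff₀ hκ, Finset.sum_mul, integral_sum_pulled_filter harm, Finset.sum_filter]
  refine Finset.sum_le_sum fun b _ => ?_
  have hlog := Real.log_natCast_nonneg T
  by_cases hgap : 0 < M.gap sel b
  · by_cases hb : 0 < Pr {ω | b ∈ M.pulled (fun t => arm t ω) T}
    · rw [if_pos ⟨hb, hgap⟩, if_pos hgap, mul_comm]
      exact mul_le_mul_of_nonneg_right (hT b hb) (by positivity)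
    · rw [if_neg fun h => hb h.1, if_pos hgap]
      positivity
  · rw [if_neg fun h => hgap h.2, if_neg hgap]

end CBB

end

theorem theorem3 (σ : NNReal) (c D : ℝ) (hc : 0 < c) (hσ : 2 * (σ : ℝ) ^ 2 < c ^ 2) :
    ∃ C : ℝ, 0 < C ∧
      ∀ (N K : ℕ) (M : CBB N K)
        (μopt : Fin N → Bool → Bool → Fin K → ℝ) (_ : M.LPOptimal μopt)
        (sel : Fin K → ℕ → (Fin N → Bool) → Finset (Fin N))
        (_ : M.IsIndexRule μopt sel)
        (_ : ∀ b, M.gap sel b ≤ D)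
        (Ω : Type*) [MeasurableSpace Ω] (Pr : Measure Ω) [IsProbabilityMeasure Pr]
        (X : M.Alloc → ℕ → Ω → ℝ) (_ : M.IsFastOracle sel Pr σ X)
        (arm : ℕ → Ω → M.Alloc) (_ : ∀ t, Measurable (arm t))
        (_ : ∀ ω, M.IsMitosisRun c (fun b n => X b n ω) (fun t => arm t ω)),
        -- the regret decomposition, along every realization and in expectation
        (∀ T ω, M.regret sel (fun t => arm t ω) T =
          ∑ b ∈ M.pulled (fun t => arm t ω) T,
            (M.pulls (fun t => arm t ω) T b : ℝ) * M.gap sel b) ∧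
        (∀ T, ∫ ω, M.regret sel (fun t => arm t ω) T ∂Pr =
          ∑ b with 0 < Pr {ω | b ∈ M.pulled (fun t => arm t ω) T},
            (∫ ω, (M.pulls (fun t => arm t ω) T b : ℝ) ∂Pr) * M.gap sel b) ∧
        -- the bound with a uniform constant, over the arms that can be pulled within `T` rounds
        (∀ T : ℕ, 2 ≤ T → ∫ ω, M.regret sel (fun t => arm t ω) T ∂Pr ≤
          C * ∑ b with 0 < Pr {ω | b ∈ M.pulled (fun t => arm t ω) T} ∧ 0 < M.gap sel b,
            Real.log T / M.gap sel b) ∧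
        (fun T : ℕ => ∫ ω, M.regret sel (fun t => arm t ω) T ∂Pr) =O[atTop]
          (fun T : ℕ => ∫ ω, (∑ b ∈ M.pulled (fun t => arm t ω) T with 0 < M.gap sel b,
            Real.log T / M.gap sel b) ∂Pr) := by
  obtain ⟨v, β, hσv, hv, hβ, hγ⟩ := CBB.exists_variance_and_ratio hσ
  set A : ℝ := ∑' t : ℕ, (1 + Real.log t / Real.log β) * (t : ℝ) ^ (-(c ^ 2 / (2 * v * β)))
    with hA
  have hlog2 : 0 < Real.log 2 := Real.log_pos one_lt_two
  have hlogβ : 0 < Real.log β := Real.log_pos hβ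
  have hA0 : 0 ≤ A := tsum_nonneg fun t => by
    have := Real.log_natCast_nonneg t
    positivity
  have hC : 0 < (A + 1) * D ^ 2 / Real.log 2 + 4 * c ^ 2 + 8 * v / Real.log 2 := by positivity
  refine ⟨_, hC, ?_⟩
  intro N K M μopt _ sel hsel hD Ω _ Pr _ X hX arm harm hrun
  obtain ⟨bopt, hopt, hLP⟩ := CBB.exists_optimal_le_LP hsel
  have hbound : ∀ T : ℕ, 2 ≤ T → _ := fun T hT =>
    CBB.integral_regret_le (sel := sel) (Pr := Pr) (T := T) harm fun b hb =>
      CBB.mul_gap_le hA0 v.2 hb (hD b)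
        (Real.log_le_log two_pos (by exact_mod_cast hT))
        (CBB.integral_pulls_le hX hσv hv hc hβ hγ harm hrun hopt hLP hb T)
  exact ⟨fun T ω => CBB.regret_eq_sum_pulled T, CBB.integral_regret_eq_sum_filter harm, hbound,
    CBB.isBigO_integral_sum_pulled harm hC.le hbound⟩
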